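/- Let $\mathcal{C}$ be a small category and $k$ a field. For a small category $\mathcal{D}$ let $\mathrm{Vect}_k^{\mathcal{D}}$ be the abelian category of covariant functors from $\mathcal{D}$ to $k$-vector spaces, let $\mathrm{Ext}^n_{k\mathcal{D}}$ denote $\mathrm{Ext}^n$ in this category, $\mathrm{Ext}^*_{k\mathcal D}=\bigoplus_{n\ge 0}\mathrm{Ext}^n_{k\mathcal D}$, and let $\underline{k}$ be the constant functor with value $k$. Let $\mathcal{C}^e=\mathcal{C}\times\mathcal{C}^{op}$, and let $k\mathcal{C}\in\mathrm{Vect}_k^{\mathcal{C}^e}$ be the functor $(x,y)\mapsto k\,\mathrm{Hom}_{\mathcal{C}}(y,x)$ (the vector space with basis $\mathrm{Hom}_{\mathcal{C}}(y,x)$), on which a morphism $(u,v^{op})$ acts by $\beta\mapsto u\beta v$. Let $F(\mathcal{C})$ be the category of factorizations in $\mathcal{C}$: its objects $[\alpha]$ are the morphisms $\alpha$ of $\mathcal{C}$, and a morphism $[\alpha]\to[\alpha']$ is a pair $(u,v^{op})$ of morphisms with $\alpha'=u\alpha v$. Let $t:F(\mathcal{C})\to\mathcal{C}$ send $[\alpha]$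 to the target of $\alpha$, and let $\tau:F(\mathcal{C})\to\mathcal{C}^e$ send $[\alpha]$ to $(x,y)$ for $\alpha\in\mathrm{Hom}_{\mathcal{C}}(y,x)$ and $(u,v^{op})$ to $(u,v^{op})$. For a functor $\theta$ let $\mathrm{Res}_\theta$ be precomposition with $\theta$; thus $\mathrm{Res}_\tau\underline{k}=\underline{k}$ and $\mathrm{Res}_t\underline{k}=\underline{k}$. Let $\iota:\underline{k}\to\mathrm{Res}_\tau(k\mathcal{C})$ be the natural transformation with $\iota_{[\alpha]}(1)=\alpha$, and let $N_{\mathcal{C}}$ be the subfunctor of $\mathrm{Res}_\tau(k\mathcal{C})$ with $N_{\mathcal{C}}([\alpha])=k\{\beta-\gamma\mid\beta,\gamma\in\mathrm{Hom}_{\mathcal{C}}(y,x)\}$ for $\alpha\in\mathrm{Hom}_{\mathcal{C}}(y,x)$. All isomorphisms of $\mathrm{Ext}$ below are isomorphisms of graded $k$-vector spaces. 1. For every functor $M\in\mathrm{Vect}_k^{\mathcal{C}^e}$, restriction along $\tau$ followed by precomposition with $\iota$ is an isomorphism $$\mathrm{Ext}^*_{k\mathcal{C}^e}(k\mathcal{C},M)\cong\mathrm{Ext}^*_{kF(\mathcal{C})}(\underline{k},\mathrm{Res}_\tau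 M).$$ 2. In particular, taking $M=\underline{k}$ for the first isomorphism, $$\mathrm{Ext}^*_{k\mathcal{C}^e}(k\mathcal{C},\underline{k})\cong\mathrm{Ext}^*_{kF(\mathcal{C})}(\underline{k},\underline{k})\cong\mathrm{Ext}^*_{k\mathcal{C}}(\underline{k},\underline{k}),$$ where the inverse of the second isomorphism is restriction along $t$. 3. The map $\iota$ and the inclusion $N_{\mathcal{C}}\subseteq\mathrm{Res}_\tau(k\mathcal{C})$ give an isomorphism $\underline{k}\oplus N_{\mathcal{C}}\cong\mathrm{Res}_\tau(k\mathcal{C})$, and this together with 1 (for $M=k\mathcal{C}$) and 2 induces isomorphisms $$\mathrm{Ext}^*_{k\mathcal{C}^e}(k\mathcal{C},k\mathcal{C})\cong\mathrm{Ext}^*_{kF(\mathcal{C})}(\underline{k},\underline{k})\oplus\mathrm{Ext}^*_{kF(\mathcal{C})}(\underline{k},N_{\mathcal{C}})\cong\mathrm{Ext}^*_{k\mathcal{C}}(\underline{k},\underline{k})\oplus\mathrm{Ext}^*_{kF(\mathcal{C})}(\underline{k},N_{\mathcal{C}}).$$ -/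

import Mathlib

open CategoryTheory CategoryTheory.Limits CategoryTheory.Abelian

universe u

namespace CatCohomology

/-! ### Functors from a small category to vector spaces -/

/-- The category `Vect_k^D` of covariant functors from a small category `D` to `k`-vector spaces;
`Ext` over `kD` is computed in this abelian category. -/
abbrev FunctorMod (k : Type u) [Field k] (D : Type u) [SmallCategory D] : Type (u + 1) :=
  D ⥤ ModuleCat.{u} k

/-- `Vect_k^D` is a Grothendieck abelian category (functors on `D` are sheaves for the trivial
topology); in particular its `Ext` groups are available in the universe `u`. -/
instance isGrothendieckAbelian_functorMod (k : Type u) [Field k] (D : Type u) [SmallCategory D] :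
    IsGrothendieckAbelian.{u} (FunctorMod k D) :=
  IsGrothendieckAbelian.of_equivalence
    ((sheafBotEquivalence (C := Dᵒᵖ) (ModuleCat.{u} k)).trans
      ((opOpEquivalence D).congrLeft (E := ModuleCat.{u} k)))

/-- The constant functor `k`: every object goes to `k`, every morphism to the identity. -/
abbrev triv (k : Type u) [Field k] (D : Type u) [SmallCategory D] : FunctorMod k D :=
  (Functor.const D).obj (ModuleCat.of k k)

/-- Restriction `Res_θ` along a functor `θ` (precomposition with `θ`). -/
abbrev Res (k : Type u) [Field k] {D E : Type u} [SmallCategory D] [SmallCategory E] (θ : D ⥤ E) :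
    FunctorMod k E ⥤ FunctorMod k D :=
  (Functor.whiskeringLeft D E (ModuleCat.{u} k)).obj θ

instance res_linear (k : Type u) [Field k] {D E : Type u} [SmallCategory D] [SmallCategory E]
    (θ : D ⥤ E) : (Res k θ).Linear k where
  map_smul _ _ := rfl

/-- The restriction of the constant functor is the constant functor. -/
def resTriv (k : Type u) [Field k] {D E : Type u} [SmallCategory D] [SmallCategory E]
    (θ : D ⥤ E) : (Res k θ).obj (triv k E) ≅ triv k D :=
  NatIso.ofComponents (fun _ => Iso.refl _)

/-- The map `Ext^n_{kE}(M, N) → Ext^n_{kD}(Res_θ M, Res_θ N)` induced by the exact functor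
`Res_θ`. -/
noncomputable def resExt (k : Type u) [Field k] {D E : Type u} [SmallCategory D] [SmallCategory E]
    (θ : D ⥤ E) (M N : FunctorMod k E) (n : ℕ) :
    Ext.{u} M N n →ₗ[k] Ext.{u} ((Res k θ).obj M) ((Res k θ).obj N) n :=
  (Res k θ).mapExtLinearMap k M N n

/-- The map `θ^* : Ext^n_{kE}(k, k) → Ext^n_{kD}(k, k)` on ordinary cohomology induced by
`θ : D ⥤ E`. -/
noncomputable def trivExt (k : Type u) [Field k] {D E : Type u} [SmallCategory D] [SmallCategory E]
    (θ : D ⥤ E) (n : ℕ) :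
    Ext.{u} (triv k E) (triv k E) n →ₗ[k] Ext.{u} (triv k D) (triv k D) n :=
  (Ext.mk₀ (resTriv k θ).inv).precompOfLinear k (triv k D) (zero_add n) ∘ₗ
    (Ext.mk₀ (resTriv k θ).hom).postcompOfLinear k ((Res k θ).obj (triv k E)) (add_zero n) ∘ₗ
      resExt k θ (triv k E) (triv k E) n

/-! ### The enveloping category and the category of factorizations -/

/-- The enveloping category `C^e = C × C^op`. -/
abbrev Env (C : Type u) [SmallCategory C] : Type u := C × Cᵒᵖ

/-- The functor `kC : C^e ⥤ Vect_k`, `(x, y) ↦ k Hom(y, x)`; a morphism `(u, v^op)` sends a basis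
element `β` to `u β v`. -/
noncomputable def catAlg (k : Type u) [Field k] (C : Type u) [SmallCategory C] :
    FunctorMod k (Env C) where
  obj p := ModuleCat.of k ((p.2.unop ⟶ p.1) →₀ k)
  map f := ModuleCat.ofHom (Finsupp.lmapDomain k k fun β => f.2.unop ≫ β ≫ f.1)
  map_id p := by
    ext β
    simp
  map_comp f g := by
    ext β
    simp

/-- The category `F(C)` of factorizations in `C`: its objects `[α]` are the morphisms of `C`. -/
structure FactCat (C : Type u) [SmallCategory C] : Type u where
  /-- the source of `α` -/
  src : C
  /-- the target of `α` -/
  tgt : C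
  /-- the morphism `α` -/
  arr : src ⟶ tgt

/-- A morphism `[α] ⟶ [α']` in `F(C)` is a pair `(u, v)` of morphisms of `C` with
`α' = u α v`. -/
@[ext]
structure FactCat.Hom {C : Type u} [SmallCategory C] (a b : FactCat C) : Type u where
  /-- the morphism `u` between the targets -/
  u : a.tgt ⟶ b.tgt
  /-- the morphism `v` between the sources, in the opposite direction -/
  v : b.src ⟶ a.src
  w : v ≫ a.arr ≫ u = b.arr

instance FactCat.category (C : Type u) [SmallCategory C] : SmallCategory (FactCat C) where
  Hom := FactCat.Hom
  id a := ⟨𝟙 _, 𝟙 _, by simp⟩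
  comp f g := ⟨f.u ≫ g.u, g.v ≫ f.v, by rw [← g.w, ← f.w]; simp⟩
  id_comp f := by apply FactCat.Hom.ext <;> simp
  comp_id f := by apply FactCat.Hom.ext <;> simp
  assoc f g h := by apply FactCat.Hom.ext <;> simp

/-- The functor `t : F(C) ⥤ C` sending `[α]` to the target of `α`. -/
def FactCat.t (C : Type u) [SmallCategory C] : FactCat C ⥤ C where
  obj a := a.tgt
  map f := FactCat.Hom.u f

/-- The functor `s : F(C) ⥤ C^op` sending `[α]` to the source of `α`. -/
def FactCat.s (C : Type u) [SmallCategory C] : FactCat C ⥤ Cᵒᵖ where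
  obj a := Opposite.op a.src
  map f := (FactCat.Hom.v f).op

/-- The functor `τ = (t, s) : F(C) ⥤ C^e`. -/
def FactCat.τ (C : Type u) [SmallCategory C] : FactCat C ⥤ Env C :=
  (FactCat.t C).prod' (FactCat.s C)

/-- The natural transformation `ι : k ⟶ Res_τ(kC)` with `ι_[α](1) = α`. -/
noncomputable def iota (k : Type u) [Field k] (C : Type u) [SmallCategory C] :
    triv k (FactCat C) ⟶ (Res k (FactCat.τ C)).obj (catAlg k C) where
  app a := ModuleCat.ofHom
    (LinearMap.toSpanSingleton k ((a.src ⟶ a.tgt) →₀ k) (Finsupp.single a.arr 1))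
  naturality a b f := by
    ext
    have h : FactCat.Hom.v f ≫ a.arr ≫ FactCat.Hom.u f = b.arr := FactCat.Hom.w f
    change (LinearMap.toSpanSingleton k ((b.src ⟶ b.tgt) →₀ k) (Finsupp.single b.arr 1)) 1 =
      Finsupp.mapDomain (fun β => FactCat.Hom.v f ≫ β ≫ FactCat.Hom.u f)
        ((LinearMap.toSpanSingleton k ((a.src ⟶ a.tgt) →₀ k) (Finsupp.single a.arr 1)) 1)
    simp [h]

/-- The subspace `k{β - γ | β, γ ∈ Hom(y, x)}` of `k Hom(y, x)`. -/
noncomputable def diffSpan (k : Type u) [Field k] {C : Type u} [SmallCategory C] (y x : C) :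
    Submodule k ((y ⟶ x) →₀ k) :=
  Submodule.span k {m | ∃ β γ : y ⟶ x, m = Finsupp.single β 1 - Finsupp.single γ 1}

lemma diffSpan_le_comap (k : Type u) [Field k] {C : Type u} [SmallCategory C] {y x y' x' : C}
    (f : x ⟶ x') (g : y' ⟶ y) :
    diffSpan k y x ≤ (diffSpan k y' x').comap
      (Finsupp.lmapDomain k k fun β : y ⟶ x => g ≫ β ≫ f) := by
  refine Submodule.span_le.2 ?_
  rintro _ ⟨β, γ, rfl⟩
  refine Submodule.subset_span ⟨g ≫ β ≫ f, g ≫ γ ≫ f, ?_⟩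
  simp [Finsupp.mapDomain_sub]

/-- The submodule `N_C` of `Res_τ(kC)`, `N_C([α]) = k{β - γ | β, γ ∈ Hom(y, x)}` for
`α ∈ Hom(y, x)`, as a functor on `F(C)`. -/
noncomputable def diffMod (k : Type u) [Field k] (C : Type u) [SmallCategory C] :
    FunctorMod k (FactCat C) where
  obj a := ModuleCat.of k (diffSpan k a.src a.tgt)
  map f := ModuleCat.ofHom (LinearMap.restrict _ (diffSpan_le_comap k (FactCat.Hom.u f)
    (FactCat.Hom.v f)))
  map_id a := by
    refine ModuleCat.hom_ext (LinearMap.ext fun m => Subtype.ext ?_)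
    exact congrArg (fun φ => φ.hom m.1) (((Res k (FactCat.τ C)).obj (catAlg k C)).map_id a)
  map_comp f g := by
    refine ModuleCat.hom_ext (LinearMap.ext fun m => Subtype.ext ?_)
    exact congrArg (fun φ => φ.hom m.1) (((Res k (FactCat.τ C)).obj (catAlg k C)).map_comp f g)

/-- The inclusion `N_C ⟶ Res_τ(kC)`. -/
noncomputable def diffIncl (k : Type u) [Field k] (C : Type u) [SmallCategory C] :
    diffMod k C ⟶ (Res k (FactCat.τ C)).obj (catAlg k C) where
  app a := ModuleCat.ofHom (diffSpan k a.src a.tgt).subtype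
  naturality _ _ _ := rfl

/-- The comparison map `Ext^n_{kC^e}(kC, M) → Ext^n_{kF(C)}(k, Res_τ M)`: restrict along `τ`, then
precompose with `ι : k ⟶ Res_τ(kC)`. -/
noncomputable def comparison (k : Type u) [Field k] (C : Type u) [SmallCategory C]
    (M : FunctorMod k (Env C)) (n : ℕ) :
    Ext.{u} (catAlg k C) M n →ₗ[k] Ext.{u} (triv k (FactCat C)) ((Res k (FactCat.τ C)).obj M) n :=
  (Ext.mk₀ (iota k C)).precompOfLinear k ((Res k (FactCat.τ C)).obj M) (zero_add n) ∘ₗ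
    resExt k (FactCat.τ C) (catAlg k C) M n

end CatCohomology

open CatCohomology

/-! Both comparison maps restrict along `θ` (`τ` or `t`) and precompose with a map `i : k ⟶ Res_θ
X`. On Hom groups they are bijective because `i` is universal (`iota_universal`,
`resTriv_universal`). Dimension shifting along embeddings into injectives extends this to every
degree (`extComparison_bijective`), provided `Ext^n(k, Res_θ I) = 0` for `n > 0` and `I` injective.

For this vanishing, take `j : E ⥤ F(C)` through which morphisms out of `θ[α]` lift functorially: the
fibres of `t`, or the discrete category of objects for `τ`. The lifts factor the restriction of `I ⟶
cofree I` through `Ran_j Res_j Res_θ I`. Since `I` is injective that embedding splits, so `Res_θ I`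
is a retract of some `Ran_j W`. The components of `E` and of the comma categories `a / j` have
initial objects, so `k` is projective on them. Hence `Ran_j` is exact, and the adjunction `Res_j ⊣
Ran_j` kills the higher `Ext` (`ext_ran_eq_zero`).

The direct sum comes from the augmentation `β ↦ 1`, which has kernel `N_C` and is split by `ι`. -/

namespace CatCohomology

/-! ### Dimension shifting in abelian categories -/

section Homological

universe v v' w w' a b

variable {A : Type a} [Category.{v} A] [Abelian A] {B : Type b} [Category.{v'} B] [Abelian B]

lemma exists_injective_shortExact [EnoughInjectives A] (W : A) :
    ∃ (I Q : A) (f : W ⟶ I) (g : I ⟶ Q) (w : f ≫ g = 0),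
      Injective I ∧ (ShortComplex.mk f g w).ShortExact :=
  ⟨_, _, Injective.ι W, cokernel.π _, cokernel.condition _, inferInstance,
    { exact := ShortComplex.exact_cokernel _ }⟩

/-- If `L ⊣ R` with `L` preserving monomorphisms and `R` exact, and `L Y` is projective, then the
higher `Ext` groups from `Y` to objects `R W` vanish. -/
lemma ext_eq_zero_of_adjunction [HasExt.{w} B] [EnoughInjectives A] {L : B ⥤ A} {R : A ⥤ B}
    (adj : L ⊣ R) [L.PreservesMonomorphisms] [R.Additive] [R.PreservesEpimorphisms]
    (Y : B) [Projective (L.obj Y)] (n : ℕ) :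
    ∀ (W : A) (x : Ext.{w} Y (R.obj W) (n + 1)), x = 0 := by
  have : PreservesLimits R := adj.rightAdjoint_preservesLimits
  -- A right adjoint is left exact, so preservation of epimorphisms is all that exactness still
  -- needs.
  have hR {W I Q : A} {f : W ⟶ I} {g : I ⟶ Q} {w : f ≫ g = 0}
      (hS : (ShortComplex.mk f g w).ShortExact) :
      (ShortComplex.mk (R.map f) (R.map g) (by rw [← R.map_comp, w, R.map_zero])).ShortExact :=
    have : Mono f := hS.mono_f
    have : Epi g := hS.epi_g
    { exact := hS.exact.map_of_mono_of_preservesKernel R hS.mono_f inferInstance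
      mono_f := inferInstanceAs (Mono (R.map f))
      epi_g := inferInstanceAs (Epi (R.map g)) }
  induction n with
  | zero =>
    intro W x
    obtain ⟨I, Q, f, g, w, _, hS⟩ := exists_injective_shortExact W
    have : Injective (R.obj I) := Injective.injective_of_adjoint adj I
    have : Epi g := hS.epi_g
    obtain ⟨z, rfl⟩ := Ext.covariant_sequence_exact₁ Y (hR hS) x
      (Ext.eq_zero_of_injective _) (zero_add 1)
    obtain ⟨z, rfl⟩ := (Ext.mk₀_bijective _ _).2 z
    obtain ⟨z, rfl⟩ := (adj.homEquiv _ _).surjective z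
    -- The transpose `L Y ⟶ Q` lifts along `g` by projectivity, so `x` factors through `R g`
    -- followed by the connecting class, which is zero.
    rw [← Projective.factorThru_comp z g, adj.homEquiv_naturality_right, ← Ext.mk₀_comp_mk₀,
      Ext.comp_assoc_of_second_deg_zero, (hR hS).comp_extClass, Ext.comp_zero]
  | succ n ih =>
    intro W x
    obtain ⟨I, Q, f, g, w, _, hS⟩ := exists_injective_shortExact W
    have : Injective (R.obj I) := Injective.injective_of_adjoint adj I
    obtain ⟨z, rfl⟩ := Ext.covariant_sequence_exact₁ Y (hR hS) x
      (Ext.eq_zero_of_injective _) rfl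
    rw [ih _ z, Ext.zero_comp]

/-- Apply the exact functor `G` to an extension and precompose with `i : Y ⟶ G X`. -/
noncomputable def extComparison [HasExt.{w} A] [HasExt.{w'} B] (G : A ⥤ B)
    [G.Additive] [PreservesFiniteLimits G] [PreservesFiniteColimits G] {X : A} {Y : B}
    (i : Y ⟶ G.obj X) (M : A) (n : ℕ) : Ext.{w} X M n →+ Ext.{w'} Y (G.obj M) n where
  toFun x := (Ext.mk₀ i).comp (x.mapExactFunctor G) (zero_add n)
  map_zero' := by simp
  map_add' := by simp

/-- Exact functors respect Yoneda products; hence the comparison commutes with connecting maps. -/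
lemma extComparison_comp [HasExt.{w} A] [HasExt.{w'} B] (G : A ⥤ B)
    [G.Additive] [PreservesFiniteLimits G] [PreservesFiniteColimits G] {X : A} {Y : B}
    (i : Y ⟶ G.obj X) {M N : A} {p q r : ℕ} (x : Ext.{w} X M p) (y : Ext.{w} M N q)
    (h : p + q = r) :
    extComparison G i N r (x.comp y h) =
      (extComparison G i M p x).comp (y.mapExactFunctor G) h := by
  simp only [extComparison, AddMonoidHom.coe_mk, ZeroHom.coe_mk]
  rw [Ext.mapExactFunctor_comp, Ext.comp_assoc _ _ _ (zero_add p) h (by lia)]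

/-- Let `G` be an exact functor and `i : Y ⟶ G X` a universal morphism. If `Y` has no higher `Ext`
into the objects `G I` with `I` injective, then `x ↦ i ≫ G x` is bijective on `Ext`. -/
lemma extComparison_bijective [HasExt.{w} A] [HasExt.{w'} B] [EnoughInjectives A] (G : A ⥤ B)
    [G.Additive] [PreservesFiniteLimits G] [PreservesFiniteColimits G] {X : A} {Y : B}
    (i : Y ⟶ G.obj X)
    (hom_bij : ∀ M : A, Function.Bijective fun f : X ⟶ M => i ≫ G.map f)
    (acyclic : ∀ (I : A) [Injective I] (n : ℕ) (x : Ext.{w'} Y (G.obj I) (n + 1)), x = 0)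
    (n : ℕ) : ∀ M : A, Function.Bijective (extComparison G i M n) := by
  induction n with
  | zero =>
    intro M
    have h : (extComparison G i M 0) ∘ (Ext.mk₀ : (X ⟶ M) → _) =
        (Ext.mk₀ : (Y ⟶ G.obj M) → _) ∘ fun f => i ≫ G.map f := by
      ext1 f
      simp [extComparison, Ext.mapExactFunctor_mk₀]
    rw [← Function.Bijective.of_comp_iff _ (Ext.mk₀_bijective X M), h]
    exact (Ext.mk₀_bijective _ _).comp (hom_bij M)
  | succ n ih =>
    intro M
    obtain ⟨I, Q, f, g, w, _, hS⟩ := exists_injective_shortExact M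
    have hGS : (ShortComplex.mk (G.map f) (G.map g)
        (by rw [← G.map_comp, w, G.map_zero])).ShortExact := hS.map_of_exact G
    have c_ext (w : Ext.{w} X Q n) :
        extComparison G i M (n + 1) (w.comp hS.extClass rfl) =
          (extComparison G i Q n w).comp hGS.extClass rfl := by
      refine (extComparison_comp G i w hS.extClass rfl).trans ?_
      rw [Ext.mapExactFunctor_extClass]
      rfl
    refine ⟨(injective_iff_map_eq_zero _).2 fun x hx => ?_, fun y => ?_⟩
    -- A four-lemma chase: surjectivity at `I` and injectivity at `Q` in degree `n` show that `w`
    -- comes from `I`, so its boundary is zero.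
    · obtain ⟨w, rfl⟩ := Ext.covariant_sequence_exact₁ X hS x (Ext.eq_zero_of_injective _) rfl
      rw [c_ext] at hx
      obtain ⟨z, hz⟩ := Ext.covariant_sequence_exact₃ Y hGS _ rfl hx
      obtain ⟨z, rfl⟩ := (ih _).2 z
      have : w = z.comp (Ext.mk₀ g) (add_zero n) :=
        (ih _).1 (by rw [← hz, extComparison_comp, Ext.mapExactFunctor_mk₀])
      rw [this, Ext.comp_assoc_of_second_deg_zero, hS.comp_extClass, Ext.comp_zero]
    -- Acyclicity of `G I` makes `y` a boundary, and surjectivity at `Q` lifts it.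
    · obtain ⟨z, rfl⟩ := Ext.covariant_sequence_exact₁ Y hGS y (acyclic I n _) rfl
      obtain ⟨w, rfl⟩ := (ih _).2 z
      exact ⟨w.comp hS.extClass rfl, c_ext w⟩

end Homological

/-! ### Projectivity of the constant functor and exactness of right Kan extension -/

section FunctorCategory

variable {k : Type u} [Field k] {D E : Type u} [SmallCategory D] [SmallCategory E]

/-- A compatible family of elements of `N` is a morphism from the constant functor. -/
def trivHom {N : FunctorMod k D} (m : ∀ a, N.obj a)
    (h : ∀ {a b : D} (f : a ⟶ b), N.map f (m a) = m b) : triv k D ⟶ N where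
  app a := ModuleCat.ofHom (LinearMap.toSpanSingleton k (N.obj a) (m a))
  naturality a b f := by
    ext
    simpa using (h f).symm

@[simp]
lemma trivHom_app_one {N : FunctorMod k D} (m : ∀ a, N.obj a)
    (h : ∀ {a b : D} (f : a ⟶ b), N.map f (m a) = m b) (a : D) :
    (trivHom m h).app a (1 : k) = m a :=
  one_smul k (m a)

lemma triv_hom_ext {N : FunctorMod k D} {f g : triv k D ⟶ N}
    (h : ∀ a, f.app a (1 : k) = g.app a (1 : k)) : f = g := by
  ext a
  exact h a

lemma map_app_one {N : FunctorMod k D} (φ : triv k D ⟶ N) {a b : D} (f : a ⟶ b) :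
    N.map f (φ.app a (1 : k)) = φ.app b (1 : k) :=
  (NatTrans.naturality_apply φ f (1 : k)).symm

/-- If every connected component of `D` has an initial object, the constant functor is
projective. -/
lemma projective_triv {ι : Type*} (comp : D → ι) (ini : ι → D) (i : ∀ a, ini (comp a) ⟶ a)
    (hcomp : ∀ {a b : D}, (a ⟶ b) → comp a = comp b)
    (huniq : ∀ c a, Subsingleton (ini c ⟶ a)) : Projective (triv k D) where
  factors {N N'} φ e _ := by
    have he (a : D) : Function.Surjective (e.app a) :=
      (ModuleCat.epi_iff_surjective _).1 inferInstance
    -- A map out of `k` is a compatible family, determined on each component by its value at the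
    -- initial object. That value may be lifted arbitrarily and then transported.
    choose n hn using fun c => he (ini c) (φ.app (ini c) (1 : k))
    have key {c c' : ι} (h : c = c') : N.map (eqToHom (congrArg ini h)) (n c) = n c' := by
      subst h
      simp
    refine ⟨trivHom (fun a => N.map (i a) (n (comp a))) fun {a b} f => ?_,
      triv_hom_ext fun a => ?_⟩
    · rw [← key (hcomp f), ← ConcreteCategory.comp_apply, ← ConcreteCategory.comp_apply,
        ← N.map_comp, ← N.map_comp, (huniq _ _).elim (i a ≫ f)]
    · rw [NatTrans.comp_app, ConcreteCategory.comp_apply, trivHom_app_one,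
        NatTrans.naturality_apply, hn, map_app_one]

/-- If the constant functor is projective, taking limits preserves epimorphisms. -/
lemma epi_limMap [Projective (triv k D)] {N N' : FunctorMod k D} (e : N ⟶ N') [Epi e] :
    Epi (limMap e) := by
  refine (ModuleCat.epi_iff_surjective _).2 fun y => ?_
  -- Elements of a limit are maps out of the constant functor, so projectivity lifts `y`.
  let φ : triv k D ⟶ N' := trivHom (fun a => limit.π N' a y) fun f => by
    rw [← ConcreteCategory.comp_apply, limit.w]
  let c : Cone N := ⟨ModuleCat.of k k, Projective.factorThru φ e⟩
  refine ⟨limit.lift N c (1 : k), Concrete.limit_ext _ _ _ fun a => ?_⟩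
  rw [← ConcreteCategory.comp_apply, limMap_π, ← ConcreteCategory.comp_apply, limit.lift_π_assoc]
  change ((Projective.factorThru φ e) ≫ e).app a (1 : k) = _
  rw [Projective.factorThru_comp]
  exact trivHom_app_one _ _ a

/-- The value of `j.ran` at `a` is a limit over `a / j`, where `epi_limMap` applies. -/
lemma ran_preservesEpimorphisms (j : E ⥤ D)
    [∀ a, Projective (triv k (StructuredArrow a j))] :
    (j.ran : FunctorMod k E ⥤ FunctorMod k D).PreservesEpimorphisms where
  preserves {W W'} e _ := by
    refine NatTrans.epi_iff_epi_app _ |>.2 fun a => ?_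
    have : Epi (Functor.whiskerLeft (StructuredArrow.proj a j) e) :=
      NatTrans.epi_iff_epi_app _ |>.2 fun b => inferInstanceAs (Epi (e.app b.right))
    have h : (j.ran.map e).app a = (j.ranObjObjIsoLimit W a).hom ≫
        limMap (Functor.whiskerLeft (StructuredArrow.proj a j) e) ≫
          (j.ranObjObjIsoLimit W' a).inv := by
      rw [← Category.assoc, Iso.eq_comp_inv]
      refine limit.hom_ext fun f => ?_
      have := congr_app (j.ranCounit.naturality e) f.right
      simp only [Functor.comp_obj, Functor.whiskeringLeft_obj_obj, Functor.id_obj,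
        Functor.comp_map, Functor.whiskeringLeft_obj_map, Functor.id_map, NatTrans.comp_app,
        Functor.whiskerLeft_app] at this
      simp only [Category.assoc, Functor.ranObjObjIsoLimit_hom_π, limMap_π,
        Functor.ranObjObjIsoLimit_hom_π_assoc, Functor.whiskerLeft_app]
      exact ((j.ran.map e).naturality_assoc f.hom _).symm.trans
        (congrArg (fun z => (j.ran.obj W).map f.hom ≫ z) this)
    rw [h]
    have := epi_limMap (Functor.whiskerLeft (StructuredArrow.proj a j) e)
    infer_instance

/-- The constant functor has no higher `Ext` into `j.ran.obj W`, if the constant functors on `E` and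
on all the comma categories `a / j` are projective. -/
lemma ext_ran_eq_zero (j : E ⥤ D) [Projective (triv k E)]
    [∀ a, Projective (triv k (StructuredArrow a j))] (W : FunctorMod k E) (n : ℕ)
    (x : Ext.{u} (triv k D) (j.ran.obj W) (n + 1)) : x = 0 := by
  have : (j.ran : FunctorMod k E ⥤ FunctorMod k D).PreservesEpimorphisms :=
    ran_preservesEpimorphisms j
  have adj : Res k j ⊣ j.ran := j.ranAdjunction _
  have : j.ran.Additive := adj.right_adjoint_additive
  have : Projective ((Res k j).obj (triv k D)) := inferInstanceAs (Projective (triv k E))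
  exact ext_eq_zero_of_adjunction adj (triv k D) n W x

end FunctorCategory

/-! ### Acyclicity of restricted injectives from functorial lifts -/

section Lifts

variable {k : Type u} [Field k] {B D E : Type u} [SmallCategory B] [SmallCategory D]
  [SmallCategory E]

/-- The functor `z ↦ ∏_{z ⟶ x} M x`. -/
def cofree (M : FunctorMod k B) : FunctorMod k B where
  obj z := ModuleCat.of k (∀ x : B, (z ⟶ x) → M.obj x)
  map f := ModuleCat.ofHom
    { toFun := fun m x g => m x (f ≫ g)
      map_add' := fun _ _ => rfl
      map_smul' := fun _ _ => rfl }
  map_id z := by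
    ext m x g
    exact congrArg (m x) (Category.id_comp g)
  map_comp f f' := by
    ext m x g
    exact congrArg (m x) (Category.assoc f f' g)

/-- The canonical embedding of `M` into `cofree M`. -/
def toCofree (M : FunctorMod k B) : M ⟶ cofree M where
  app z := ModuleCat.ofHom (LinearMap.pi fun x => LinearMap.pi fun g => (M.map g).hom)
  naturality z z' f := by
    ext m
    funext x g
    exact (ConcreteCategory.congr_hom (M.map_comp f g) m).symm

/-- The coordinate at the identity recovers the element. -/
instance mono_toCofree (M : FunctorMod k B) : Mono (toCofree M) := by
  refine NatTrans.mono_iff_mono_app _ |>.2 fun z =>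
    (ModuleCat.mono_iff_injective _).2 fun m m' h => ?_
  have : M.map (𝟙 z) m = M.map (𝟙 z) m' := congrFun (congrFun h z) (𝟙 z)
  simpa using this

/-- Functorial lifts along `θ : D ⥤ B` of morphisms of `B`, through a functor `j : E ⥤ D`. -/
structure Lifts (θ : D ⥤ B) (j : E ⥤ D) where
  /-- the target of the lift -/
  obj {α : D} {x : B} (g : θ.obj α ⟶ x) : E
  /-- the lift -/
  hom {α : D} {x : B} (g : θ.obj α ⟶ x) : α ⟶ j.obj (obj g)
  /-- the comparison between the image of the target and the original target -/
  proj {α : D} {x : B} (g : θ.obj α ⟶ x) : θ.obj (j.obj (obj g)) ⟶ x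
  /-- the functoriality of the target -/
  map {α α' : D} {x : B} (φ : α ⟶ α') (g : θ.obj α' ⟶ x) : obj (θ.map φ ≫ g) ⟶ obj g
  fac {α : D} {x : B} (g : θ.obj α ⟶ x) : θ.map (hom g) ≫ proj g = g
  hom_map {α α' : D} {x : B} (φ : α ⟶ α') (g : θ.obj α' ⟶ x) :
    hom (θ.map φ ≫ g) ≫ j.map (map φ g) = φ ≫ hom g
  map_proj {α α' : D} {x : B} (φ : α ⟶ α') (g : θ.obj α' ⟶ x) :
    θ.map (j.map (map φ g)) ≫ proj g = proj (θ.map φ ≫ g)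

variable {θ : D ⥤ B} {j : E ⥤ D}

/-- The components of `Lifts.ranHom`. -/
noncomputable def Lifts.ranComponent (l : Lifts θ j) (M : FunctorMod k B) {α : D} {x : B}
    (g : θ.obj α ⟶ x) : (j.ran.obj (j ⋙ θ ⋙ M)).obj α ⟶ M.obj x :=
  (j.ran.obj (j ⋙ θ ⋙ M)).map (l.hom g) ≫ (j.ranCounit.app (j ⋙ θ ⋙ M)).app (l.obj g) ≫
    M.map (l.proj g)

lemma Lifts.map_ranComponent (l : Lifts θ j) (M : FunctorMod k B) {α α' : D} {x : B}
    (φ : α ⟶ α') (g : θ.obj α' ⟶ x) :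
    (j.ran.obj (j ⋙ θ ⋙ M)).map φ ≫ l.ranComponent M g =
      l.ranComponent M (θ.map φ ≫ g) := by
  have h := (j.ranCounit.app (j ⋙ θ ⋙ M)).naturality (l.map φ g)
  dsimp at h
  simp only [Lifts.ranComponent]
  rw [← Functor.map_comp_assoc, ← l.hom_map, ← l.map_proj, M.map_comp, ← reassoc_of% h,
    Functor.map_comp, Category.assoc]

/-- Naturality of the unit and a triangle identity leave `M` applied to the factorization `fac` of
`g`. -/
lemma Lifts.unit_ranComponent (l : Lifts θ j) (M : FunctorMod k B) {α : D} {x : B}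
    (g : θ.obj α ⟶ x) :
    ((j.ranAdjunction _).unit.app (θ ⋙ M)).app α ≫ l.ranComponent M g = M.map g := by
  have h := ((j.ranAdjunction _).unit.app (θ ⋙ M)).naturality (l.hom g)
  dsimp at h
  simp only [Lifts.ranComponent]
  rw [← reassoc_of% h]
  have h' := j.ranCounit_app_app_ranAdjunction_unit_app_app (θ ⋙ M) (l.obj g)
  rw [reassoc_of% h', ← M.map_comp, l.fac]

/-- The comparison between the right Kan extension of a restriction and the restriction of a
cofree functor. -/
noncomputable def Lifts.ranHom (l : Lifts θ j) (M : FunctorMod k B) :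
    j.ran.obj (j ⋙ θ ⋙ M) ⟶ θ ⋙ cofree M where
  app α := ModuleCat.ofHom (LinearMap.pi fun x => LinearMap.pi fun g => (l.ranComponent M g).hom)
  naturality α α' φ := by
    ext m
    funext x g
    exact ConcreteCategory.congr_hom (l.map_ranComponent M φ g) m

lemma Lifts.unit_ranHom (l : Lifts θ j) (M : FunctorMod k B) :
    (j.ranAdjunction _).unit.app (θ ⋙ M) ≫ l.ranHom M = Functor.whiskerLeft θ (toCofree M) := by
  ext α m
  funext x g
  exact ConcreteCategory.congr_hom (l.unit_ranComponent M g) m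

/-- If morphisms of `B` lift functorially along `θ` through `j`, and the constant functors on `E`
and on the comma categories `a / j` are projective, the constant functor on `D` has no higher `Ext`
into the restrictions of injective functors on `B`. -/
lemma Lifts.ext_res_eq_zero (l : Lifts θ j) [Projective (triv k E)]
    [∀ a, Projective (triv k (StructuredArrow a j))] (I : FunctorMod k B) [Injective I] (n : ℕ)
    (x : Ext.{u} (triv k D) ((Res k θ).obj I) (n + 1)) : x = 0 := by
  let i : (Res k θ).obj I ⟶ j.ran.obj (j ⋙ θ ⋙ I) := (j.ranAdjunction _).unit.app (θ ⋙ I)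
  let r : j.ran.obj (j ⋙ θ ⋙ I) ⟶ (Res k θ).obj I :=
    l.ranHom I ≫ Functor.whiskerLeft θ (Injective.factorThru (𝟙 I) (toCofree I))
  -- Injectivity of `I` gives a retraction of `toCofree I`, making `Res_θ I` a retract of a right
  -- Kan extension.
  have h : i ≫ r = 𝟙 _ := by
    rw [← Category.assoc, l.unit_ranHom, ← Functor.whiskerLeft_comp, Injective.comp_factorThru]
    rfl
  rw [← Ext.comp_mk₀_id x, ← h, ← Ext.mk₀_comp_mk₀, ← Ext.comp_assoc_of_third_deg_zero,
    ext_ran_eq_zero j (j ⋙ θ ⋙ I) n (x.comp (Ext.mk₀ i) (add_zero _)), Ext.zero_comp]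

end Lifts

/-! ### Lifts and comma categories for `t` and `τ` -/

section FactCat

variable (k : Type u) [Field k] (C : Type u) [SmallCategory C]

variable {C} in
lemma FactCat.w_assoc {α β : FactCat C} (φ : FactCat.Hom α β) {x : C} (g : β.tgt ⟶ x) :
    φ.v ≫ α.arr ≫ φ.u ≫ g = β.arr ≫ g := by
  rw [← φ.w, Category.assoc, Category.assoc]

/-- The inclusion of the fibres of `t : F(C) ⥤ C`; the fibre over `x` is `(C / x)ᵒᵖ`. -/
def fiberInclusion : (Σ x : C, (Over x)ᵒᵖ) ⥤ FactCat C :=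
  Sigma.desc fun x =>
    { obj f := ⟨f.unop.left, x, f.unop.hom⟩
      map h := ⟨𝟙 x, h.unop.left, by simp⟩
      map_id _ := rfl
      map_comp f g := FactCat.Hom.ext (Category.comp_id _).symm rfl }

/-- The identity of `x` is terminal in `Over x`, hence initial in the opposite category. -/
instance projective_triv_fibers : Projective (triv k (Σ x : C, (Over x)ᵒᵖ)) := by
  refine projective_triv Sigma.fst (fun x => ⟨x, Opposite.op (Over.mk (𝟙 x))⟩)
    (fun ⟨x, f⟩ => Sigma.SigmaHom.mk (Over.mkIdTerminal.from f.unop).op) ?_ ?_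
  · rintro _ _ ⟨f⟩
    rfl
  · rintro x ⟨y, f⟩
    refine ⟨?_⟩
    rintro ⟨g⟩ ⟨h⟩
    exact congrArg Sigma.SigmaHom.mk (Quiver.Hom.unop_inj (Over.mkIdTerminal.hom_ext _ _))

/-- Lifts of morphisms along `t : F(C) ⥤ C`. -/
def liftsT : Lifts (FactCat.t C) (fiberInclusion C) where
  obj {α x} g := ⟨x, Opposite.op (Over.mk (α.arr ≫ g))⟩
  hom {α x} g := ⟨g, 𝟙 _, Category.id_comp _⟩
  proj {α x} g := 𝟙 x
  map {α α' x} φ g := Sigma.SigmaHom.mk (Quiver.Hom.op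
    (Over.homMk (FactCat.Hom.v φ) (FactCat.w_assoc φ g)))
  fac g := Category.comp_id _
  hom_map φ g := FactCat.Hom.ext (Category.comp_id _) (by
    exact (Category.comp_id _).trans (Category.id_comp _).symm)
  map_proj φ g := Category.comp_id _

/-- Fibre morphisms have `u = 𝟙`, so the `u` of an object `(u, v)` is constant on components. Since
`(u, v)` factors uniquely as `(u, 𝟙)` followed by `(𝟙, v)`, the object `(u, 𝟙) : [α] ⟶ [uα]` is
initial among those with this `u`. -/
instance projective_triv_comma_fiberInclusion (α : FactCat C) :
    Projective (triv k (StructuredArrow α (fiberInclusion C))) := by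
  refine projective_triv (ι := Σ x : C, (α.tgt ⟶ x))
    (fun s => ⟨((fiberInclusion C).obj s.right).tgt, FactCat.Hom.u s.hom⟩)
    (fun c => StructuredArrow.mk (Y := (liftsT C).obj (α := α) c.2) ((liftsT C).hom c.2))
    ?_ ?_ ?_
  · rintro ⟨_, ⟨x, f⟩, h⟩
    refine StructuredArrow.homMk (Sigma.SigmaHom.mk (Quiver.Hom.op
      (Over.homMk (FactCat.Hom.v h) (FactCat.Hom.w h)))) ?_
    exact FactCat.Hom.ext (Category.comp_id _) (Category.comp_id _)
  · rintro ⟨_, ⟨x, f⟩, h⟩ ⟨_, ⟨y, g⟩, h'⟩ ⟨l, ⟨r⟩, w⟩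
    have e : h' = h ≫ (fiberInclusion C).map (Sigma.SigmaHom.mk r) :=
      (StructuredArrow.w (CommaMorphism.mk l (Sigma.SigmaHom.mk r) w)).symm
    exact congrArg (Sigma.mk x) ((congrArg FactCat.Hom.u e).trans (Category.comp_id _)).symm
  · rintro c ⟨_, ⟨y, f⟩, h⟩
    refine ⟨?_⟩
    rintro ⟨l, ⟨g⟩, w⟩ ⟨l', ⟨g'⟩, w'⟩
    have e := (StructuredArrow.w (CommaMorphism.mk l (Sigma.SigmaHom.mk g) w)).trans
      (StructuredArrow.w (CommaMorphism.mk l' (Sigma.SigmaHom.mk g') w')).symm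
    have e' : g.unop.left ≫ 𝟙 α.src = g'.unop.left ≫ 𝟙 α.src := congrArg FactCat.Hom.v e
    replace e' := (Category.comp_id _).symm.trans (e'.trans (Category.comp_id _))
    exact StructuredArrow.hom_ext _ _
      (congrArg Sigma.SigmaHom.mk (Quiver.Hom.unop_inj (Over.OverMorphism.ext e')))

variable {C} in
lemma FactCat.eqToHom_u {y x : C} {f g : y ⟶ x} (h : f = g) :
    FactCat.Hom.u (eqToHom (congrArg (FactCat.mk y x) h)) = 𝟙 x := by
  subst h
  rfl

variable {C} in
lemma FactCat.eqToHom_v {y x : C} {f g : y ⟶ x} (h : f = g) :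
    FactCat.Hom.v (eqToHom (congrArg (FactCat.mk y x) h)) = 𝟙 y := by
  subst h
  rfl

-- The lifts of `g` and of `τ(φ) ≫ g` end at the same object of `F(C)`, which is why a discrete `E`
-- suffices for `τ`. The equality is only propositional, hence the `eqToHom` lemmas.
variable {C} in
lemma FactCat.comp_arr_comp {α β : FactCat C} (φ : α ⟶ β) {x : Env C}
    (g : (FactCat.τ C).obj β ⟶ x) :
    ((FactCat.τ C).map φ ≫ g).2.unop ≫ α.arr ≫ ((FactCat.τ C).map φ ≫ g).1 =
      g.2.unop ≫ β.arr ≫ g.1 := by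
  exact (Category.assoc _ _ _).trans (congrArg (g.2.unop ≫ ·) (FactCat.w_assoc φ g.1))

/-- Lifts of morphisms along `τ : F(C) ⥤ C^e`. -/
def liftsτ : Lifts (FactCat.τ C) (Discrete.functor (id : FactCat C → FactCat C)) where
  obj {α x} g := ⟨⟨x.2.unop, x.1, g.2.unop ≫ α.arr ≫ g.1⟩⟩
  hom {α x} g := ⟨g.1, g.2.unop, rfl⟩
  proj {α x} g := 𝟙 x
  map {α α' x} φ g := Discrete.eqToHom (congrArg (FactCat.mk _ _) (FactCat.comp_arr_comp φ g))
  fac g := Category.comp_id _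
  hom_map φ g := by
    have hu := FactCat.eqToHom_u (FactCat.comp_arr_comp φ g)
    have hv := FactCat.eqToHom_v (FactCat.comp_arr_comp φ g)
    exact FactCat.Hom.ext ((congrArg (_ ≫ ·) hu).trans (Category.comp_id _))
      ((congrArg (· ≫ _) hv).trans (Category.id_comp _))
  map_proj φ g := by
    have hu := FactCat.eqToHom_u (FactCat.comp_arr_comp φ g)
    have hv := FactCat.eqToHom_v (FactCat.comp_arr_comp φ g)
    exact Prod.ext ((congrArg (· ≫ 𝟙 _) hu).trans (Category.comp_id _))
      (Quiver.Hom.unop_inj ((congrArg (𝟙 _ ≫ ·) hv).trans (Category.id_comp _)))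

instance projective_triv_discrete (X : Type u) : Projective (triv k (Discrete X)) :=
  projective_triv Discrete.as Discrete.mk (fun _ => 𝟙 _) (fun f => Discrete.eq_of_hom f)
    fun _ _ => inferInstance

/-- The comma category is itself discrete: each pair `(x, a ⟶ F x)` is its own component. -/
instance projective_triv_comma_discrete {X D : Type u} [SmallCategory D] (F : X → D) (a : D) :
    Projective (triv k (StructuredArrow a (Discrete.functor F))) := by
  refine projective_triv (ι := Σ x : X, (a ⟶ F x)) (fun s => ⟨s.right.as, s.hom⟩)
    (fun c => StructuredArrow.mk (Y := Discrete.mk c.1) c.2)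
    (fun s => StructuredArrow.homMk (𝟙 s.right)) ?_ ?_
  · rintro ⟨_, ⟨x⟩, h⟩ ⟨_, ⟨y⟩, h'⟩ ⟨l, r, w⟩
    obtain rfl : x = y := Discrete.eq_of_hom r
    obtain rfl : r = 𝟙 _ := Subsingleton.elim _ _
    have e : h' = h ≫ (Discrete.functor F).map (𝟙 _) :=
      (StructuredArrow.w (CommaMorphism.mk l (𝟙 (Discrete.mk x)) w)).symm
    rw [CategoryTheory.Functor.map_id] at e
    exact congrArg (Sigma.mk x) (e.trans (Category.comp_id _)).symm
  · exact fun c s => ⟨fun f g => StructuredArrow.hom_ext _ _ (Subsingleton.elim _ _)⟩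

end FactCat

/-! ### `Ext` into isomorphic objects and biproducts -/

section Biproducts

universe v w a

variable {A : Type a} [Category.{v} A] [Abelian A] [HasExt.{w} A] (k : Type*) [CommRing k]
  [Linear k A]

/-- Postcomposition with an isomorphism on `Ext`. -/
noncomputable def extPostcompIso (X : A) {Y Z : A} (e : Y ≅ Z) (n : ℕ) :
    Ext.{w} X Y n ≃ₗ[k] Ext.{w} X Z n :=
  LinearEquiv.ofLinearMap ((Ext.mk₀ e.hom).postcompOfLinear k X (add_zero n))
    ((Ext.mk₀ e.inv).postcompOfLinear k X (add_zero n))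
    (by
      ext x
      change (x.comp (Ext.mk₀ e.inv) (add_zero n)).comp (Ext.mk₀ e.hom) (add_zero n) = x
      simp)
    (by
      ext x
      change (x.comp (Ext.mk₀ e.hom) (add_zero n)).comp (Ext.mk₀ e.inv) (add_zero n) = x
      simp)

/-- The comparison with the biproduct, for a biproduct given by morphisms and their relations. -/
noncomputable def biprodIso {A : Type a} [Category.{v} A] [Abelian A] {Y₁ Y₂ Z : A}
    (i₁ : Y₁ ⟶ Z) (i₂ : Y₂ ⟶ Z) (p₁ : Z ⟶ Y₁) (p₂ : Z ⟶ Y₂)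
    (h₁₁ : i₁ ≫ p₁ = 𝟙 _) (h₁₂ : i₁ ≫ p₂ = 0) (h₂₁ : i₂ ≫ p₁ = 0) (h₂₂ : i₂ ≫ p₂ = 𝟙 _)
    (total : p₁ ≫ i₁ + p₂ ≫ i₂ = 𝟙 _) : Y₁ ⊞ Y₂ ≅ Z where
  hom := biprod.desc i₁ i₂
  inv := biprod.lift p₁ p₂
  hom_inv_id := by ext <;> simp [h₁₁, h₁₂, h₂₁, h₂₂]
  inv_hom_id := by rw [biprod.lift_desc, total]

/-- `Ext` into a biproduct, for a biproduct given by morphisms and their relations. -/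
noncomputable def extProdEquiv (X : A) {Y₁ Y₂ Z : A} (i₁ : Y₁ ⟶ Z) (i₂ : Y₂ ⟶ Z) (p₁ : Z ⟶ Y₁)
    (p₂ : Z ⟶ Y₂) (h₁₁ : i₁ ≫ p₁ = 𝟙 _) (h₁₂ : i₁ ≫ p₂ = 0) (h₂₁ : i₂ ≫ p₁ = 0)
    (h₂₂ : i₂ ≫ p₂ = 𝟙 _) (total : p₁ ≫ i₁ + p₂ ≫ i₂ = 𝟙 _) (n : ℕ) :
    (Ext.{w} X Y₁ n × Ext.{w} X Y₂ n) ≃ₗ[k] Ext.{w} X Z n :=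
  LinearEquiv.ofLinearMap
    (((Ext.mk₀ i₁).postcompOfLinear k X (add_zero n)).coprod
      ((Ext.mk₀ i₂).postcompOfLinear k X (add_zero n)))
    (((Ext.mk₀ p₁).postcompOfLinear k X (add_zero n)).prod
      ((Ext.mk₀ p₂).postcompOfLinear k X (add_zero n)))
    (by
      ext x
      change (x.comp (Ext.mk₀ p₁) (add_zero n)).comp (Ext.mk₀ i₁) (add_zero n) +
        (x.comp (Ext.mk₀ p₂) (add_zero n)).comp (Ext.mk₀ i₂) (add_zero n) = x
      simp only [Ext.comp_assoc_of_third_deg_zero, Ext.mk₀_comp_mk₀]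
      rw [← Ext.comp_add, ← Ext.mk₀_add, total, Ext.comp_mk₀_id])
    (by
      refine LinearMap.ext fun ⟨x, y⟩ => Prod.ext ?_ ?_
      · change (x.comp (Ext.mk₀ i₁) (add_zero n) + y.comp (Ext.mk₀ i₂) (add_zero n)).comp
          (Ext.mk₀ p₁) (add_zero n) = x
        simp [h₁₁, h₂₁]
      · change (x.comp (Ext.mk₀ i₁) (add_zero n) + y.comp (Ext.mk₀ i₂) (add_zero n)).comp
          (Ext.mk₀ p₂) (add_zero n) = y
        simp [h₁₂, h₂₂])

end Biproducts

/-! ### Universality in degree zero and the two comparison isomorphisms -/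

section Comparison

variable (k : Type u) [Field k] (C : Type u) [SmallCategory C]

lemma iota_app_one (a : FactCat C) : (iota k C).app a (1 : k) = Finsupp.single a.arr (1 : k) :=
  one_smul k _

lemma catAlg_map_single {p q : Env C} (f : p ⟶ q) (β : p.2.unop ⟶ p.1) :
    (catAlg k C).map f (Finsupp.single β (1 : k)) =
      Finsupp.single (f.2.unop ≫ β ≫ f.1) (1 : k) :=
  Finsupp.mapDomain_single

variable {k C} in
lemma iota_comp_app_one {M : FunctorMod k (Env C)} (f : catAlg k C ⟶ M) {p : Env C}
    (β : p.2.unop ⟶ p.1) :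
    (iota k C ≫ (Res k (FactCat.τ C)).map f).app ⟨_, _, β⟩ (1 : k) =
      f.app p (Finsupp.single β (1 : k)) :=
  congrArg (f.app p) (iota_app_one k C ⟨_, _, β⟩)

/-- The basis elements of `kC` are the objects of `F(C)`. A map out of `kC` is a family `m_β` with
`M(u, v) m_β = m_{uβv}`, which is exactly a compatible family on `F(C)`. -/
lemma iota_universal (M : FunctorMod k (Env C)) :
    Function.Bijective fun f : catAlg k C ⟶ M => iota k C ≫ (Res k (FactCat.τ C)).map f := by
  refine ⟨fun f g h => ?_, fun φ => ?_⟩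
  · refine NatTrans.ext (funext fun p => ModuleCat.hom_ext
      (Finsupp.lhom_ext' fun β : p.2.unop ⟶ p.1 => LinearMap.ext_ring ?_))
    change f.app p (Finsupp.single β (1 : k)) = g.app p (Finsupp.single β (1 : k))
    have h : iota k C ≫ (Res k (FactCat.τ C)).map f = iota k C ≫ (Res k (FactCat.τ C)).map g := h
    rw [← iota_comp_app_one f, h, iota_comp_app_one g]
  · have single_eq (p : Env C) (β : p.2.unop ⟶ p.1) :
        Finsupp.linearCombination k (fun β : p.2.unop ⟶ p.1 =>
          (φ.app ⟨_, _, β⟩ (1 : k) : M.obj p)) (Finsupp.single β 1) =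
            φ.app ⟨_, _, β⟩ (1 : k) :=
      (Finsupp.linearCombination_single _ _ _).trans (one_smul _ _)
    let ψ : catAlg k C ⟶ M :=
      { app p := ModuleCat.ofHom (Finsupp.linearCombination k
          fun β : p.2.unop ⟶ p.1 => (φ.app ⟨_, _, β⟩ (1 : k) : M.obj p))
        naturality p q f := by
          refine ModuleCat.hom_ext
            (Finsupp.lhom_ext' fun β : p.2.unop ⟶ p.1 => LinearMap.ext_ring ?_)
          let g : FactCat.mk _ _ β ⟶ FactCat.mk _ _ (f.2.unop ≫ β ≫ f.1) := ⟨f.1, f.2.unop, rfl⟩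
          refine (congrArg _ (catAlg_map_single k C f β)).trans ((single_eq q _).trans ?_)
          exact (map_app_one φ g).symm.trans (congrArg (M.map f) (single_eq p β).symm) }
    exact ⟨ψ, triv_hom_ext fun α => (iota_comp_app_one ψ (p := (α.tgt, .op α.src)) α.arr).trans
      (single_eq (α.tgt, .op α.src) α.arr)⟩

lemma comparison_bijective (M : FunctorMod k (Env C)) (n : ℕ) :
    Function.Bijective (comparison k C M n) :=
  extComparison_bijective (Res k (FactCat.τ C)) (iota k C) (iota_universal k C)
    (fun I _ n x => (liftsτ C).ext_res_eq_zero I n x) n M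

/-- The morphism `(𝟙, f) : [𝟙 x] ⟶ [f]` shows that a compatible family depends only on the target of
`f`; then `(f, 𝟙) : [𝟙 y] ⟶ [f]` gives compatibility over `C`. -/
lemma resTriv_universal (M : FunctorMod k C) :
    Function.Bijective fun f : triv k C ⟶ M =>
      (resTriv k (FactCat.t C)).inv ≫ (Res k (FactCat.t C)).map f := by
  refine ⟨fun f g h => triv_hom_ext fun x => ?_, fun φ => ?_⟩
  · exact congrArg (fun φ => φ.app ⟨x, x, 𝟙 x⟩ (1 : k)) h
  · have key {y x : C} (f : y ⟶ x) : φ.app ⟨y, x, f⟩ (1 : k) = φ.app ⟨x, x, 𝟙 x⟩ (1 : k) := by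
      let g : FactCat.mk x x (𝟙 x) ⟶ FactCat.mk y x f := ⟨𝟙 x, f, by simp⟩
      exact (map_app_one φ g).symm.trans (ConcreteCategory.congr_hom (M.map_id x) _)
    have key' {y x : C} (f : y ⟶ x) :
        M.map f (φ.app ⟨y, y, 𝟙 y⟩ (1 : k)) = φ.app ⟨y, x, f⟩ (1 : k) := by
      let g : FactCat.mk y y (𝟙 y) ⟶ FactCat.mk y x f := ⟨f, 𝟙 y, by simp⟩
      exact map_app_one φ g
    let ψ : triv k C ⟶ M := trivHom (fun x => φ.app ⟨x, x, 𝟙 x⟩ (1 : k))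
      fun f => (key' f).trans (key f)
    have hψ (x : C) : ψ.app x (1 : k) = φ.app ⟨x, x, 𝟙 x⟩ (1 : k) := trivHom_app_one _ _ x
    exact ⟨ψ, triv_hom_ext fun α => (hψ α.tgt).trans (key α.arr).symm⟩

lemma trivExt_t_bijective (n : ℕ) : Function.Bijective (trivExt k (FactCat.t C) n) := by
  have h := extComparison_bijective (Res k (FactCat.t C)) (resTriv k (FactCat.t C)).inv
    (resTriv_universal k C) (fun I _ n x => (liftsT C).ext_res_eq_zero I n x) n (triv k C)
  -- `trivExt` also identifies the coefficients `Res_t k` with `k`; associativity moves this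
  -- isomorphism outside.
  have e : ⇑(trivExt k (FactCat.t C) n) =
      extPostcompIso k (triv k (FactCat C)) (resTriv k (FactCat.t C)) n ∘
        extComparison (Res k (FactCat.t C)) (resTriv k (FactCat.t C)).inv (triv k C) n :=
    funext fun x => (Ext.comp_assoc_of_third_deg_zero _ _ _ (zero_add n)).symm
  rw [e]
  exact (extPostcompIso k _ _ n).bijective.comp h

end Comparison

/-! ### The splitting of `Res_τ(kC)` -/

section Decomposition

variable (k : Type u) [Field k] (C : Type u) [SmallCategory C]

/-- The augmentation `Res_τ(kC) ⟶ k`, sending every basis element to `1`. -/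
noncomputable def augmentation : (Res k (FactCat.τ C)).obj (catAlg k C) ⟶ triv k (FactCat C) where
  app a := ModuleCat.ofHom (Finsupp.linearCombination k fun _ : a.src ⟶ a.tgt => (1 : k))
  naturality a b f := by
    refine ModuleCat.hom_ext (Finsupp.lhom_ext' fun β => LinearMap.ext_ring ?_)
    exact (congrArg (Finsupp.linearCombination k fun _ : b.src ⟶ b.tgt => (1 : k))
      Finsupp.mapDomain_single).trans ((Finsupp.linearCombination_single _ _ _).trans
        (Finsupp.linearCombination_single k (v := fun _ : a.src ⟶ a.tgt => (1 : k)) 1 β).symm)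

lemma iota_augmentation : iota k C ≫ augmentation k C = 𝟙 _ := by
  refine triv_hom_ext fun a => ?_
  refine (congrArg ((augmentation k C).app a) (iota_app_one k C a)).trans ?_
  exact (Finsupp.linearCombination_single _ _ _).trans (one_smul _ _)

lemma linearCombination_one_eq_zero_of_mem_diffSpan {y x : C} {m : (y ⟶ x) →₀ k}
    (hm : m ∈ diffSpan k y x) :
    Finsupp.linearCombination k (fun _ : y ⟶ x => (1 : k)) m = 0 := by
  have : diffSpan k y x ≤ LinearMap.ker (Finsupp.linearCombination k fun _ : y ⟶ x => (1 : k)) := by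
    refine Submodule.span_le.2 ?_
    rintro _ ⟨β, γ, rfl⟩
    simp
  exact this hm

lemma diffIncl_augmentation : diffIncl k C ≫ augmentation k C = 0 := by
  ext a m
  exact linearCombination_one_eq_zero_of_mem_diffSpan k C m.2

/-- By linearity only a basis element `β` matters, where the difference is `β - α`, with `α = a.arr`
as base point. -/
lemma sub_augmentation_mem_diffSpan (a : FactCat C) (m : (a.src ⟶ a.tgt) →₀ k) :
    m - Finsupp.linearCombination k (fun _ : a.src ⟶ a.tgt => (1 : k)) m •
      Finsupp.single a.arr 1 ∈ diffSpan k a.src a.tgt := by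
  induction m using Finsupp.induction_linear with
  | zero => simp
  | add f g hf hg =>
    rw [map_add, add_smul, add_sub_add_comm]
    exact add_mem hf hg
  | single β c =>
    have h : Finsupp.single β c - Finsupp.linearCombination k (fun _ : a.src ⟶ a.tgt => (1 : k))
        (Finsupp.single β c) • Finsupp.single a.arr 1 =
          c • (Finsupp.single β 1 - Finsupp.single a.arr 1) := by
      simp [smul_sub]
    rw [h]
    exact Submodule.smul_mem _ _ (Submodule.subset_span ⟨β, a.arr, rfl⟩)

/-- The projection `Res_τ(kC) ⟶ N_C` along `iota`. -/
noncomputable def diffProj : (Res k (FactCat.τ C)).obj (catAlg k C) ⟶ diffMod k C where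
  app a := ModuleCat.ofHom
    (LinearMap.codRestrict (diffSpan k a.src a.tgt)
      (LinearMap.id - (LinearMap.toSpanSingleton k _ (Finsupp.single a.arr 1)) ∘ₗ
        Finsupp.linearCombination k (fun _ : a.src ⟶ a.tgt => (1 : k)))
      fun m => sub_augmentation_mem_diffSpan k C a m)
  naturality a b f := by
    ext m
    exact Subtype.ext (ConcreteCategory.congr_hom
      ((𝟙 _ - augmentation k C ≫ iota k C).naturality f) m)

/-- This is the idempotent complementary to the one splitting off `k`; the remaining biproduct
relations follow by cancelling the monomorphism `diffIncl`. -/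
lemma diffProj_diffIncl : diffProj k C ≫ diffIncl k C = 𝟙 _ - augmentation k C ≫ iota k C := rfl

instance mono_diffIncl : Mono (diffIncl k C) :=
  NatTrans.mono_iff_mono_app _ |>.2 fun _ =>
    (ModuleCat.mono_iff_injective _).2 Subtype.val_injective

lemma iota_diffProj : iota k C ≫ diffProj k C = 0 := by
  rw [← cancel_mono (diffIncl k C), Category.assoc, diffProj_diffIncl, Preadditive.comp_sub,
    ← Category.assoc, iota_augmentation, Category.comp_id, Category.id_comp, sub_self, zero_comp]

lemma diffIncl_diffProj : diffIncl k C ≫ diffProj k C = 𝟙 _ := by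
  rw [← cancel_mono (diffIncl k C), Category.assoc, diffProj_diffIncl, Preadditive.comp_sub,
    ← Category.assoc, diffIncl_augmentation, zero_comp, sub_zero, Category.comp_id,
    Category.id_comp]

lemma augmentation_iota_add_diffProj_diffIncl :
    augmentation k C ≫ iota k C + diffProj k C ≫ diffIncl k C = 𝟙 _ := by
  rw [diffProj_diffIncl, add_sub_cancel]

/-- The decomposition of `Res_τ(kC)` as the direct sum of `k` and `N_C`. -/
noncomputable def trivBiprodDiffIso :
    triv k (FactCat C) ⊞ diffMod k C ≅ (Res k (FactCat.τ C)).obj (catAlg k C) :=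
  biprodIso (iota k C) (diffIncl k C) (augmentation k C) (diffProj k C) (iota_augmentation k C)
    (iota_diffProj k C) (diffIncl_augmentation k C) (diffIncl_diffProj k C)
    (augmentation_iota_add_diffProj_diffIncl k C)

end Decomposition
end CatCohomology

open CatCohomology
theorem proposition2p3p5 (k : Type u) [Field k] (C : Type u) [SmallCategory C] :
    ∃ (Φ : ∀ (M : FunctorMod k (Env C)) (n : ℕ),
          Ext.{u} (catAlg k C) M n ≃ₗ[k]
            Ext.{u} (triv k (FactCat C)) ((Res k (FactCat.τ C)).obj M) n)
      (Ψ : ∀ n : ℕ, Ext.{u} (catAlg k C) (triv k (Env C)) n ≃ₗ[k]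
          Ext.{u} (triv k (FactCat C)) (triv k (FactCat C)) n)
      (T : ∀ n : ℕ, Ext.{u} (triv k (FactCat C)) (triv k (FactCat C)) n ≃ₗ[k]
          Ext.{u} (triv k C) (triv k C) n)
      (e : triv k (FactCat C) ⊞ diffMod k C ≅ (Res k (FactCat.τ C)).obj (catAlg k C))
      (A : ∀ n : ℕ, Ext.{u} (catAlg k C) (catAlg k C) n ≃ₗ[k]
          Ext.{u} (triv k (FactCat C)) (triv k (FactCat C)) n ×
            Ext.{u} (triv k (FactCat C)) (diffMod k C) n)
      (B : ∀ n : ℕ, Ext.{u} (catAlg k C) (catAlg k C) n ≃ₗ[k]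
          Ext.{u} (triv k C) (triv k C) n × Ext.{u} (triv k (FactCat C)) (diffMod k C) n),
      (∀ M n x, Φ M n x = comparison k C M n x) ∧
      (∀ n x, Ψ n x = (Φ (triv k (Env C)) n x).comp
          (Ext.mk₀ (resTriv k (FactCat.τ C)).hom) (add_zero n)) ∧
      (∀ n x, (T n).symm x = trivExt k (FactCat.t C) n x) ∧
      biprod.inl ≫ e.hom = iota k C ∧
      biprod.inr ≫ e.hom = diffIncl k C ∧
      (∀ n a b, Φ (catAlg k C) n ((A n).symm (a, b)) =
          a.comp (Ext.mk₀ (iota k C)) (add_zero n) +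
            b.comp (Ext.mk₀ (diffIncl k C)) (add_zero n)) ∧
      (∀ n x, B n x = (T n (A n x).1, (A n x).2)) := by
  let Φ (M : FunctorMod k (Env C)) (n : ℕ) :=
    LinearEquiv.ofBijective (comparison k C M n) (comparison_bijective k C M n)
  -- Taking the inverse here makes `(T n).symm` restriction along `t` by definition.
  let T (n : ℕ) :=
    (LinearEquiv.ofBijective (trivExt k (FactCat.t C) n) (trivExt_t_bijective k C n)).symm
  let S (n : ℕ) := extProdEquiv k (triv k (FactCat C)) (iota k C) (diffIncl k C)
    (augmentation k C) (diffProj k C) (iota_augmentation k C) (iota_diffProj k C)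
    (diffIncl_augmentation k C) (diffIncl_diffProj k C)
    (augmentation_iota_add_diffProj_diffIncl k C) n
  let A (n : ℕ) := Φ (catAlg k C) n ≪≫ₗ (S n).symm
  refine ⟨Φ, fun n => Φ (triv k (Env C)) n ≪≫ₗ extPostcompIso k _ (resTriv k (FactCat.τ C)) n, T,
    trivBiprodDiffIso k C, A,
    fun n => A n ≪≫ₗ (T n).prodCongr (LinearEquiv.refl k _),
    fun _ _ _ => rfl, fun _ _ => rfl, fun _ _ => rfl, biprod.inl_desc _ _, biprod.inr_desc _ _,
    fun n a b => (Φ (catAlg k C) n).apply_symm_apply (S n (a, b)), fun _ _ => rfl⟩
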